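/- Let $M=(m_{ij})_{i,j\in I}$ be a right-angled Coxeter matrix over a finite index set $I$ (that is, $m_{ij}\in\{2,\infty\}$ for all $i\neq j$), and let $\Delta$ be a semiregular building of type $M$ with parameters $(q_i)_{i\in I}$, viewed as a chamber system: every $i$-panel has the same, possibly infinite, cardinality $q_i\ge 2$. For each $i\in I$ let $X_i$ be a set with $|X_i|=q_i$, and let $\lambda=(\lambda_i)_{i\in I}\colon\Delta\to\prod_{i\in I}X_i$ be a legal colouring, i.e. on every $i$-panel $\lambda_i$ restricts to a bijection onto $X_i$ and $\lambda_j$ is constant for every $j\ne i$. For each $i\in I$ let $F_i\le\mathrm{Sym}(X_i)$ be a permutation group. Let $$U_\Delta(\boldsymbol F)=\{g\in\mathrm{Aut}(\Delta)\mid \lambda_i|_{g\mathcal P}\circ g|_{\mathcal P}\circ(\lambda_i|_{\mathcal P})^{-1}\in F_i\text{ for every } i\in I\text{ and every } i\text{-panel }\mathcal P\}$$ be the universal group, where $\mathrm{Aut}(\Delta)$ is the group of type-preserving automorphisms of $\Delta$, and let $U_\Delta(\boldsymbol F)^+$ be the subgroup of $U_\Delta(\boldsymbol F)$ generated by the stabilisers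 in $U_\Delta(\boldsymbol F)$ of all chambers. For each $i\in I$ let $\equiv_i$ be the equivalence relation on $X_i$ whose classes are the orbits of $F_i$, and let $I'$ be the set of those $i\in I$ for which $\equiv_i$ is not the universal relation. Let $(\tau,\Delta')$ be an implosion of $\Delta$ with respect to the relations $\equiv_i$; that is, $\Delta'$ is a semiregular right-angled building over $I'$ whose diagram is induced by that of $\Delta$, with parameters $q'_i=|X_i/{\equiv_i}|$ for $i\in I'$, equipped with a legal colouring $\lambda'$ with colour sets $X_i/{\equiv_i}$, and $\tau\colon\Delta\to\Delta'$ is a surjective map such that $\lambda'_i(\tau(c))=[\lambda_i(c)]_i$ for all chambers $c$ of $\Delta$ and all $i\in I'$, and $\mathrm{dist}_{\Delta'}(\tau(c_1),\tau(c_2))\le\mathrm{dist}_\Delta(c_1,c_2)$ (gallery distances) for all chambers $c_1,c_2$ of $\Delta$. Then $U_\Delta(\boldsymbol F)^+$ stabilises every fibre of $\tau$: for every $g\in U_\Delta(\boldsymbol F)^+$ and every chamber $y$ of $\Delta'$, $g(\tau^{-1}(y))=\tau^{-1}(y)$. -/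

import Mathlib

/-- A chamber system over `I` with chamber set `C`: for every `i`, the equivalence relation
of `i`-adjacency. -/
structure ChamberSystem (I : Type*) (C : Type*) where
  adj : I → Setoid C

/-- The Coxeter diagram is right-angled; Mathlib encodes `m_{ij} = ∞` by `M i j = 0`. -/
def CoxeterMatrix.IsRightAngled {I : Type*} (M : CoxeterMatrix I) : Prop :=
  ∀ i j, i ≠ j → M i j = 2 ∨ M i j = 0

/-- The Coxeter diagram induced on a subset of the index set. -/
def CoxeterMatrix.induced {I : Type*} (M : CoxeterMatrix I) (p : I → Prop) :
    CoxeterMatrix {i // p i} where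
  M := fun i j => M i.1 j.1
  isSymm := by
    ext i j
    exact M.symmetric j.1 i.1
  diagonal := fun i => M.diagonal i.1
  off_diagonal := fun i j h => M.off_diagonal i.1 j.1 (fun e => h (Subtype.ext e))

namespace ChamberSystem

variable {I C : Type*}

/-- The `i`-panel containing the chamber `c`. -/
def panel (Δ : ChamberSystem I C) (i : I) (c : C) : Set C := {d | (Δ.adj i).r c d}

/-- `Δ.Joined f c d`: there is a (non-stammering) gallery of type `f` from `c` to `d`. -/
def Joined (Δ : ChamberSystem I C) : List I → C → C → Prop
  | [], c, d => c = d
  | i :: f, c, d => ∃ e, c ≠ e ∧ (Δ.adj i).r c e ∧ Δ.Joined f e d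

/-- `Δ` is a building of type `M`: every panel has at least two chambers, and there is a distance
function with values in the Coxeter group `W` of type `M` such that, for every reduced word `f`,
`δ c d` is the element of `W` represented by `f` if and only if `c` and `d` are joined by a gallery
of type `f`. -/
structure IsBuilding (Δ : ChamberSystem I C) (M : CoxeterMatrix I) : Prop where
  nonempty : Nonempty C
  two_le_panel : ∀ i c, ∃ d, d ≠ c ∧ (Δ.adj i).r c d
  exists_weylDist : ∃ δ : C → C → M.Group, ∀ f : List I, M.toCoxeterSystem.IsReduced f →
    ∀ c d, δ c d = M.toCoxeterSystem.wordProd f ↔ Δ.Joined f c d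

/-- `Δ` is semiregular with parameters `q_i = |X i| ≥ 2`. -/
def IsSemiregular (Δ : ChamberSystem I C) (X : I → Type*) : Prop :=
  ∀ i, Nontrivial (X i) ∧ ∀ c, Nonempty (Δ.panel i c ≃ X i)

/-- The graph on the chambers whose edges join distinct adjacent chambers. Its (extended) graph
distance is the gallery distance. -/
def graph (Δ : ChamberSystem I C) : SimpleGraph C where
  Adj c d := c ≠ d ∧ ∃ i, (Δ.adj i).r c d
  symm := ⟨fun _ _ h => ⟨h.1.symm, h.2.imp fun i hi => (Δ.adj i).iseqv.symm hi⟩⟩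
  loopless := ⟨fun _ h => h.1 rfl⟩

/-- The group of (type-preserving) automorphisms of `Δ`. -/
def Aut (Δ : ChamberSystem I C) : Subgroup (Equiv.Perm C) where
  carrier := {g | ∀ i c d, (Δ.adj i).r (g c) (g d) ↔ (Δ.adj i).r c d}
  one_mem' := fun _ _ _ => Iff.rfl
  mul_mem' := fun {g h} hg hh i c d => (hg i (h c) (h d)).trans (hh i c d)
  inv_mem' := fun {g} hg i c d => by
    have := hg i (g⁻¹ c) (g⁻¹ d)
    simpa using this.symm

/-- A legal colouring `λ : C → ∏ i, X i` of `Δ`; `colour i` is its `i`-th component `λ_i`. -/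
structure LegalColouring (Δ : ChamberSystem I C) (X : I → Type*) where
  colour : ∀ i, C → X i
  bijective : ∀ i c, Function.Bijective (fun d : Δ.panel i c => colour i d.1)
  constant : ∀ i j, j ≠ i → ∀ c d, (Δ.adj i).r c d → colour j c = colour j d

/-- The bijection `g|_P : P → g P`, where `P` is the `i`-panel of `c`. -/
def panelMap (Δ : ChamberSystem I C) (g : Δ.Aut) (i : I) (c : C) :
    Δ.panel i c ≃ Δ.panel i (g.1 c) :=
  g.1.subtypeEquiv fun d => (g.2 i c d).symm

namespace LegalColouring

variable {Δ : ChamberSystem I C} {X : I → Type*}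

/-- The bijection `λ_i|_P : P → X i`, where `P` is the `i`-panel of `c`. -/
noncomputable def panelEquiv (l : LegalColouring Δ X) (i : I) (c : C) : Δ.panel i c ≃ X i :=
  Equiv.ofBijective _ (l.bijective i c)

/-- The local action `λ_i|_{gP} ∘ g|_P ∘ (λ_i|_P)⁻¹` of `g` at the `i`-panel `P` of `c`. -/
noncomputable def localAction (l : LegalColouring Δ X) (g : Δ.Aut) (i : I) (c : C) :
    Equiv.Perm (X i) :=
  ((l.panelEquiv i c).symm.trans (Δ.panelMap g i c)).trans (l.panelEquiv i (g.1 c))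

theorem localAction_colour (l : LegalColouring Δ X) (g : Δ.Aut) (i : I) (c d : C)
    (h : (Δ.adj i).r c d) : l.localAction g i c (l.colour i d) = l.colour i (g.1 d) := by
  have h1 : l.panelEquiv i c ⟨d, h⟩ = l.colour i d := rfl
  rw [← h1]
  simp only [localAction, Equiv.trans_apply, Equiv.symm_apply_apply]
  rfl

theorem exists_colour (l : LegalColouring Δ X) (i : I) (c : C) (x : X i) :
    ∃ d, (Δ.adj i).r c d ∧ l.colour i d = x := by
  obtain ⟨⟨d, hd⟩, h⟩ := (l.bijective i c).2 x
  exact ⟨d, hd, h⟩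

theorem localAction_one (l : LegalColouring Δ X) (i : I) (c : C) :
    l.localAction 1 i c = 1 := by
  ext x
  obtain ⟨d, hd, rfl⟩ := l.exists_colour i c x
  exact l.localAction_colour 1 i c d hd

theorem localAction_mul (l : LegalColouring Δ X) (g h : Δ.Aut) (i : I) (c : C) :
    l.localAction (g * h) i c = l.localAction g i (h.1 c) * l.localAction h i c := by
  ext x
  obtain ⟨d, hd, rfl⟩ := l.exists_colour i c x
  rw [Equiv.Perm.mul_apply, l.localAction_colour h i c d hd, l.localAction_colour _ i c d hd,
    l.localAction_colour g i _ _ ((h.2 i c d).2 hd)]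
  rfl

theorem localAction_inv (l : LegalColouring Δ X) (g : Δ.Aut) (i : I) (c : C) :
    l.localAction g⁻¹ i c = (l.localAction g i (g⁻¹.1 c))⁻¹ := by
  have h := l.localAction_mul g g⁻¹ i c
  rw [mul_inv_cancel, localAction_one] at h
  exact (inv_eq_of_mul_eq_one_right h.symm).symm

/-- The universal group `U_Δ^λ(F)`: the automorphisms all of whose local actions at `i`-panels
lie in `F i`, for every `i`. -/
noncomputable def universalGroup (l : LegalColouring Δ X) (F : ∀ i, Subgroup (Equiv.Perm (X i))) :
    Subgroup Δ.Aut where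
  carrier := {g | ∀ i c, l.localAction g i c ∈ F i}
  one_mem' := fun i c => by
    rw [localAction_one]
    exact (F i).one_mem
  mul_mem' := fun {g h} hg hh i c => by
    rw [localAction_mul]
    exact (F i).mul_mem (hg i _) (hh i c)
  inv_mem' := fun {g} hg i c => by
    rw [localAction_inv]
    exact (F i).inv_mem (hg i _)

/-- The subgroup `U_Δ^λ(F)⁺` of `U_Δ^λ(F)` generated by the stabilisers in `U_Δ^λ(F)` of
all chambers. -/
noncomputable def universalGroupPlus (l : LegalColouring Δ X)
    (F : ∀ i, Subgroup (Equiv.Perm (X i))) : Subgroup Δ.Aut :=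
  ⨆ c : C, l.universalGroup F ⊓ MulAction.stabilizer Δ.Aut c

end LegalColouring

/-- The index `i` belongs to `I'`, i.e. the relation `≡_i` is not the universal relation. -/
def NotUniversal {X : I → Type*} (r : ∀ i, Setoid (X i)) (i : I) : Prop :=
  ¬ ∀ x y : X i, (r i).r x y

/-- `(τ, Δ')` is an implosion of `Δ` (of type `M`, with legal colouring `l`) with respect to the
equivalence relations `r i`: `Δ'` is a semiregular building over `I'` whose diagram is induced by
`M`, with parameters `|X i / r i|` and legal colouring `l'` by the quotient sets `X i / r i`, and
`τ : Δ → Δ'` is surjective, compatible with the colourings, and nonexpansive for the gallery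
distances. -/
structure IsImplosion {C' : Type*} {X : I → Type*} (M : CoxeterMatrix I)
    (Δ : ChamberSystem I C) (l : LegalColouring Δ X) (r : ∀ i, Setoid (X i))
    (Δ' : ChamberSystem {i // NotUniversal r i} C')
    (l' : LegalColouring Δ' (fun i => Quotient (r i.1))) (τ : C → C') : Prop where
  isBuilding : Δ'.IsBuilding (M.induced (NotUniversal r))
  isSemiregular : Δ'.IsSemiregular (fun i => Quotient (r i.1))
  surjective : Function.Surjective τ
  colour_eq : ∀ (i : {i // NotUniversal r i}) (c : C),
    l'.colour i (τ c) = Quotient.mk (r i.1) (l.colour i.1 c)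
  nonexpansive : ∀ c d : C, Δ'.graph.edist (τ c) (τ d) ≤ Δ.graph.edist c d

end ChamberSystem

/-!
In a chamber system with a legal colouring, the chambers at gallery distance at most one from a
given chamber are pairwise distinguished by their colours. Hence two nonexpansive maps from a
connected graph that have the same colours everywhere and agree at one vertex are equal. If `g` in
`U(F)` fixes a chamber, this applies to `τ ∘ g` and `τ`: the colours of `τ` are classes modulo the
orbits of the groups `F i`, and `g` preserves these orbits.
-/

namespace ChamberSystem

variable {I C : Type*} {Δ : ChamberSystem I C}

theorem Joined.reachable {f : List I} {c d : C} (h : Δ.Joined f c d) : Δ.graph.Reachable c d := by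
  induction f generalizing c with
  | nil => exact (show c = d from h) ▸ .rfl
  | cons i f ih =>
    obtain ⟨e, hne, hce, hed⟩ := h
    have hadj : Δ.graph.Adj c e := ⟨hne, i, hce⟩
    exact hadj.reachable.trans (ih hed)

theorem IsBuilding.preconnected_graph {M : CoxeterMatrix I} (hΔ : Δ.IsBuilding M) :
    Δ.graph.Preconnected := by
  intro c d
  obtain ⟨δ, hδ⟩ := hΔ.exists_weylDist
  obtain ⟨f, hf, hw⟩ := M.toCoxeterSystem.exists_isReduced (δ c d)
  exact ((hδ f hf c d).1 hw).reachable

theorem graph_adj_smul_iff (g : Δ.Aut) {c d : C} :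
    Δ.graph.Adj (g • c) (g • d) ↔ Δ.graph.Adj c d :=
  and_congr (MulAction.injective g).ne_iff (exists_congr fun i => g.2 i c d)

namespace LegalColouring

variable {X : I → Type*}

theorem injOn_panel (l : LegalColouring Δ X) (i : I) (c : C) :
    Set.InjOn (l.colour i) (Δ.panel i c) :=
  Set.injOn_iff_injective.2 (l.bijective i c).injective

theorem eq_of_edist_le_one_of_colour_eq (l : LegalColouring Δ X) {c d e : C}
    (hd : Δ.graph.edist c d ≤ 1) (he : Δ.graph.edist c e ≤ 1)
    (h : ∀ i, l.colour i d = l.colour i e) : d = e := by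
  have self_mem_panel (i : I) : c ∈ Δ.panel i c := (Δ.adj i).refl c
  rw [SimpleGraph.edist_le_one_iff_adj_or_eq] at hd he
  obtain ⟨-, i, hi⟩ | rfl := hd <;> obtain ⟨hce, j, hj⟩ | rfl := he
  · obtain rfl | hji := eq_or_ne j i
    · exact l.injOn_panel j c hi hj (h j)
    · have hcolour : l.colour j c = l.colour j e := (l.constant i j hji c d hi).trans (h j)
      exact absurd (l.injOn_panel j c (self_mem_panel j) hj hcolour) hce
  · exact l.injOn_panel i c hi (self_mem_panel i) (h i)
  · exact l.injOn_panel j c (self_mem_panel j) hj (h j)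
  · rfl

theorem eq_of_reachable_of_colour_eq (l : LegalColouring Δ X) {V : Type*} {G : SimpleGraph V}
    {σ τ : V → C} (hσ : ∀ u v, G.Adj u v → Δ.graph.edist (σ u) (σ v) ≤ 1)
    (hτ : ∀ u v, G.Adj u v → Δ.graph.edist (τ u) (τ v) ≤ 1)
    (hcolour : ∀ i v, l.colour i (σ v) = l.colour i (τ v)) {u v : V} (huv : G.Reachable u v)
    (hu : σ u = τ u) : σ v = τ v := by
  obtain ⟨p⟩ := huv
  induction p with
  | nil => exact hu
  | cons hadj _ ih =>
    exact ih <| l.eq_of_edist_le_one_of_colour_eq (hσ _ _ hadj) (hu ▸ hτ _ _ hadj) fun i =>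
      hcolour i _

theorem orbitRel_colour_smul (l : LegalColouring Δ X) {F : ∀ i, Subgroup (Equiv.Perm (X i))}
    {g : Δ.Aut} (hg : g ∈ l.universalGroup F) (i : I) (c : C) :
    MulAction.orbitRel (F i) (X i) (l.colour i (g • c)) (l.colour i c) :=
  ⟨⟨l.localAction g i c, hg i c⟩, l.localAction_colour g i c c ((Δ.adj i).refl c)⟩

theorem apply_smul_eq_of_smul_eq {I' C' : Type*} {Δ' : ChamberSystem I' C'} {Y : I' → Type*}
    (l' : LegalColouring Δ' Y) (hΔ : Δ.graph.Preconnected) {τ : C → C'}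
    (hτ : ∀ c d, Δ'.graph.edist (τ c) (τ d) ≤ Δ.graph.edist c d) {g : Δ.Aut}
    (hcolour : ∀ j d, l'.colour j (τ (g • d)) = l'.colour j (τ d)) {c : C} (hc : g • c = c)
    (d : C) : τ (g • d) = τ d := by
  have hτ_adj (a b : C) (hab : Δ.graph.Adj a b) : Δ'.graph.edist (τ a) (τ b) ≤ 1 :=
    (hτ a b).trans_eq (SimpleGraph.edist_eq_one_iff_adj.2 hab)
  exact l'.eq_of_reachable_of_colour_eq (σ := fun a => τ (g • a))
    (fun a b hab => hτ_adj _ _ ((graph_adj_smul_iff g).2 hab)) hτ_adj hcolour (hΔ c d)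
    (congrArg τ hc)

end LegalColouring

end ChamberSystem

theorem mainTheorem10_general {I I' C C' : Type*} {X : I → Type*} {Y : I' → Type*}
    {Δ : ChamberSystem I C} (hΔ : Δ.graph.Preconnected) (l : ChamberSystem.LegalColouring Δ X)
    (F : ∀ i, Subgroup (Equiv.Perm (X i)))
    {Δ' : ChamberSystem I' C'} (l' : ChamberSystem.LegalColouring Δ' Y)
    (ι : I' → I) (π : ∀ j, X (ι j) → Y j)
    (hF : ∀ j, MulAction.orbitRel (F (ι j)) (X (ι j)) ≤ Setoid.ker (π j))
    (τ : C → C') (hcolour : ∀ j c, l'.colour j (τ c) = π j (l.colour (ι j) c))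
    (hτ : ∀ c d, Δ'.graph.edist (τ c) (τ d) ≤ Δ.graph.edist c d) :
    ∀ g ∈ l.universalGroupPlus F, ∀ y : C',
      (fun c => g • c) '' (τ ⁻¹' {y}) = τ ⁻¹' {y} := by
  intro g hg y
  have apply_smul (d : C) : τ (g • d) = τ d := by
    induction hg using Subgroup.iSup_induction' generalizing d with
    | hp c g hg =>
      refine l'.apply_smul_eq_of_smul_eq hΔ hτ (fun j a => ?_) hg.2 d
      rw [hcolour, hcolour]
      exact hF j (l.orbitRel_colour_smul hg.1 (ι j) a)
    | h1 => rw [one_smul]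
    | hmul g₁ g₂ _ _ h₁ h₂ => rw [mul_smul, h₁, h₂]
  have comp_smul : τ ∘ (fun c => g • c) = τ := funext apply_smul
  calc (fun c => g • c) '' (τ ⁻¹' {y})
      = (fun c => g • c) '' ((fun c => g • c) ⁻¹' (τ ⁻¹' {y})) := by
        rw [← Set.preimage_comp, comp_smul]
    _ = τ ⁻¹' {y} := Set.image_preimage_eq _ (MulAction.surjective g)

theorem mainTheorem10 {I : Type*} [Finite I] {C C' : Type*} {X : I → Type*}
    (M : CoxeterMatrix I) (hM : M.IsRightAngled)
    (Δ : ChamberSystem I C) (hΔ : Δ.IsBuilding M) (hq : Δ.IsSemiregular X)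
    (l : ChamberSystem.LegalColouring Δ X)
    (F : ∀ i, Subgroup (Equiv.Perm (X i)))
    (Δ' : ChamberSystem
      {i // ChamberSystem.NotUniversal (fun j => MulAction.orbitRel (F j) (X j)) i} C')
    (l' : ChamberSystem.LegalColouring Δ'
      (fun i => Quotient (MulAction.orbitRel (F i.1) (X i.1))))
    (τ : C → C')
    (hτ : ChamberSystem.IsImplosion M Δ l (fun j => MulAction.orbitRel (F j) (X j)) Δ' l' τ) :
    ∀ g ∈ l.universalGroupPlus F, ∀ y : C',
      (fun c => g • c) '' (τ ⁻¹' {y}) = τ ⁻¹' {y} := by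
  exact mainTheorem10_general hΔ.preconnected_graph l F l' Subtype.val (fun _ => Quotient.mk _)
    (fun _ _ _ => Quotient.sound) τ hτ.colour_eq hτ.nonexpansive
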